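/- Let $q$ be a prime power, $r\ge 2$ an integer, $K=\mathbb F_{q^r}$ and $c=\frac{q^r-1}{q-1}$. Let $Y_r\subseteq\mathbb P^2_K$ be the norm-trace curve with affine equation $$x^c=y^{q^{r-1}}+y^{q^{r-2}}+\cdots+y^q+y,$$ and let $\pi:C_r\to Y_r$ be its normalization. There is exactly one point $Q_\infty$ of $C_r$ over $P_\infty=(0:1:0)$ and exactly one point $Q_0$ over $P_0=(0:0:1)$. For a divisor $D$ on $C_r$ let $L(D)$ be its Riemann–Roch space, write $N(s)=\dim_K L(sQ_\infty)$, and let $$\mathcal B_s=\{x^iy^j:\ i,j\ge 0,\ i<q^r,\ j<q^{r-1},\ iq^{r-1}+jc\le s\}.$$ Let $d,a,b$ be integers with $0<d<q$, $0\le a\le c-1$ and $0<b\le d$, and put $s=dc-a$. Then $\mathcal B_s$ is a basis of $L(sQ_\infty)$, $$\dim_K H^0\bigl(C_r,\pi^*(\mathcal O_{Y_r}(d))(-aQ_\infty-bQ_0)\bigr)=N(s)-b,$$ and this space of sections (a section being identified with the rational function obtained by dividing it by $z^d$, where $(x:y:z)$ are the homogeneous coordinates and $z=0$ is the line at infinity)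 is spanned by the monomials in $\mathcal B_s$ that vanish to order at least $b$ at $Q_0$. -/

import Mathlib

noncomputable section

open Polynomial WithZero

namespace NormTrace

/-! ### Places, divisors and Riemann–Roch spaces of a function field `F / K` -/

/-- A place of `F / K`: a discrete valuation ring of `F` containing `K`, with fraction field `F`.
When `F / K` is an algebraic function field of one variable, these are the closed points of the
smooth projective curve over `K` with function field `F`. -/
@[ext]
structure Place (K F : Type*) [Field K] [Field F] [Algebra K F] where
  ring : ValuationSubring F
  algebraMap_mem : ∀ k : K, algebraMap K F k ∈ ring
  isDVR : IsDiscreteValuationRing ring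

namespace Place

variable {K F : Type*} [Field K] [Field F] [Algebra K F]

/-- The normalized discrete valuation of a place, written multiplicatively:
`P.val f = exp (-ord_P f)` for `f ≠ 0`, and `P.val 0 = 0`. -/
def val (P : Place K F) : Valuation F ℤᵐ⁰ :=
  haveI := P.isDVR
  (IsDiscreteValuationRing.maximalIdeal P.ring).valuation F

theorem val_le_one_of_mem (P : Place K F) {f : F} (hf : f ∈ P.ring) : P.val f ≤ 1 := by
  have := P.isDVR
  exact (IsDiscreteValuationRing.maximalIdeal P.ring).valuation_le_one (K := F)
    (⟨f, hf⟩ : P.ring)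

theorem val_algebraMap_le_one (P : Place K F) (k : K) : P.val (algebraMap K F k) ≤ 1 :=
  P.val_le_one_of_mem (P.algebraMap_mem k)

/-- For homogeneous coordinates `u = (u₀ : u₁ : u₂)` in `F`, the largest absolute value
of a coordinate. A coordinate attaining it generates, at `P`, the pull-back of `𝒪(1)` under the
morphism to the projective plane defined by `u`. -/
def height (P : Place K F) (u : Fin 3 → F) : ℤᵐ⁰ :=
  max (max (P.val (u 0)) (P.val (u 1))) (P.val (u 2))

/-- The morphism to the projective plane defined by `u` sends `P` to the rational point
`(p₀ : p₁ : p₂)`: after dividing `u` by a coordinate of largest absolute value and reducing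
modulo the maximal ideal of `P`, one gets a vector proportional to `p`
(all `2 × 2` minors vanish). -/
def LiesOver (P : Place K F) (u : Fin 3 → F) (p : Fin 3 → K) : Prop :=
  ∀ i j, P.val (algebraMap K F (p i) * u j - algebraMap K F (p j) * u i) < P.height u

end Place

section Sections

variable {K F : Type*} [Field K] [Field F] [Algebra K F]

/-- The functions `f` with `|f|_P ≤ B P` at every place `P`. -/
def boundedBy (B : Place K F → ℤᵐ⁰) : Submodule K F where
  carrier := {f | ∀ P, P.val f ≤ B P}
  zero_mem' P := by simp
  add_mem' hf hg P := (P.val.map_add _ _).trans (max_le (hf P) (hg P))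
  smul_mem' k f hf P := by
    rw [Algebra.smul_def, map_mul]
    exact (mul_le_of_le_one_left' (P.val_algebraMap_le_one k)).trans (hf P)

/-- The Riemann–Roch space `L(D) = {f | f = 0 or ord_P f ≥ -D(P) for all P}`. -/
def riemannRoch (D : Place K F →₀ ℤ) : Submodule K F :=
  boundedBy fun P => exp (D P)

/-- The global sections of `π^* 𝒪(d) (-E)`, where `π` is the morphism to the projective plane
with homogeneous coordinates `u`, and `u 2` is not zero. The section `f · u₂ ^ d` is recorded as
the function `f`. If `t` is a coordinate of largest absolute value at `P`, then `t ^ d` generates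
`π^* 𝒪(d)` at `P`; so the order of vanishing of the section there is that of
`f · (u₂ / t) ^ d`, and it has to be at least `E(P)`. -/
def sectionsOfForms (u : Fin 3 → F) (d : ℕ) (E : Place K F →₀ ℤ) : Submodule K F :=
  boundedBy fun P => exp (-(E P)) * (P.height u / P.val (u 2)) ^ d

end Sections

/-! ### The norm-trace curve -/

/-- `c = (q ^ r - 1) / (q - 1)`. -/
def normExp (q r : ℕ) : ℕ := (q ^ r - 1) / (q - 1)

/-- The trace polynomial `Y ^ (q ^ (r - 1)) + ⋯ + Y ^ q + Y`. -/
def tracePoly (q r : ℕ) (K : Type*) [Field K] : K[X] := ∑ i ∈ Finset.range r, X ^ q ^ i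

/-- The equation `X ^ c - (Y ^ (q ^ (r - 1)) + ⋯ + Y ^ q + Y)` of the affine norm-trace curve,
as a polynomial in `X` over `K[Y]`. -/
def curvePoly (q r : ℕ) (K : Type*) [Field K] : K[X][X] :=
  X ^ normExp q r - C (tracePoly q r K)

/-- The affine coordinate ring `K[X, Y] / (X ^ c - Tr Y)`. -/
abbrev CoordRing (q r : ℕ) (K : Type*) [Field K] : Type _ := AdjoinRoot (curvePoly q r K)

theorem normExp_pos {q r : ℕ} (hq : 2 ≤ q) (hr : 1 ≤ r) : 0 < normExp q r := by
  have h : q ≤ q ^ r := Nat.le_self_pow (by omega) q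
  exact Nat.div_pos (by omega) (by omega)

theorem irreducible_curvePoly {q r : ℕ} (K : Type*) [Field K] (hq : 2 ≤ q) (hr : 1 ≤ r) :
    Irreducible (curvePoly q r K) := by
  have hc := normExp_pos hq hr
  have hmonic : (curvePoly q r K).Monic := monic_X_pow_sub_C _ hc.ne'
  have hdeg : (curvePoly q r K).degree = normExp q r := degree_X_pow_sub_C hc _
  have hT0 : (tracePoly q r K).coeff 0 = 0 := by
    rw [tracePoly, finsetSum_coeff]
    refine Finset.sum_eq_zero fun i _ => ?_
    rw [coeff_X_pow, if_neg (pow_pos (by omega : 0 < q) i).ne]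
  have hT1 : (tracePoly q r K).coeff 1 = 1 := by
    rw [tracePoly, finsetSum_coeff, Finset.sum_eq_single 0]
    · simp
    · intro i _ hi
      rw [coeff_X_pow, if_neg (Nat.one_lt_pow hi (by omega)).ne]
    · intro h
      exact absurd (Finset.mem_range.2 (by omega)) h
  have hP : (Ideal.span {(X : K[X])}).IsPrime :=
    (Ideal.span_singleton_prime X_ne_zero).2 prime_X
  refine irreducible_of_eisenstein_criterion hP ?_ ?_ ?_ ?_ hmonic.isPrimitive
  · rw [hmonic.leadingCoeff]
    exact fun h => hP.ne_top ((Ideal.eq_top_iff_one _).2 h)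
  · intro n hn
    rw [hdeg] at hn
    have hn' : n < normExp q r := by exact_mod_cast hn
    rw [curvePoly, coeff_sub, coeff_X_pow, if_neg hn'.ne, coeff_C, zero_sub]
    refine Ideal.neg_mem_iff _ |>.2 ?_
    split_ifs
    · exact Ideal.mem_span_singleton.2 (X_dvd_iff.2 hT0)
    · exact Ideal.zero_mem _
  · rw [hdeg]
    exact_mod_cast hc
  · rw [Ideal.span_singleton_pow, Ideal.mem_span_singleton, curvePoly, coeff_sub, coeff_X_pow,
      if_neg hc.ne, coeff_C_zero, zero_sub, dvd_neg]
    intro h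
    have := X_pow_dvd_iff.1 h 1 (by norm_num)
    rw [hT1] at this
    exact one_ne_zero this

instance (q r : ℕ) (K : Type*) [Field K] [hq : Fact (IsPrimePow q)] [hr : Fact (2 ≤ r)] :
    IsDomain (CoordRing q r K) :=
  AdjoinRoot.isDomain_of_prime
    (irreducible_curvePoly K hq.out.two_le (one_le_two.trans hr.out)).prime

/-- The function field of the norm-trace curve; its places are the closed points of the
normalization of the curve. -/
abbrev FunctionField (q r : ℕ) (K : Type*) [Field K] : Type _ := FractionRing (CoordRing q r K)

section Curve

variable (q r : ℕ) (K : Type*) [Field K] [Fact (IsPrimePow q)] [Fact (2 ≤ r)]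

/-- The coordinate function `x`. -/
def x : FunctionField q r K :=
  algebraMap (CoordRing q r K) (FunctionField q r K) (AdjoinRoot.root (curvePoly q r K))

/-- The coordinate function `y`. -/
def y : FunctionField q r K :=
  algebraMap (CoordRing q r K) (FunctionField q r K) (AdjoinRoot.of (curvePoly q r K) X)

/-- The normalization map to the plane projective norm-trace curve, in homogeneous coordinates
`(x : y : 1)`. -/
def coords : Fin 3 → FunctionField q r K := ![x q r K, y q r K, 1]

/-- The monomial `x ^ i * y ^ j`, for `e = (i, j)`. -/
def monomial (e : ℕ × ℕ) : FunctionField q r K := x q r K ^ e.1 * y q r K ^ e.2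

end Curve

/-- The exponents `(i, j)` with `i < q ^ r`, `j < q ^ (r - 1)` and `i q ^ (r - 1) + j c ≤ s`. -/
def basisExponents (q r : ℕ) (s : ℤ) : Set (ℕ × ℕ) :=
  {e | e.1 < q ^ r ∧ e.2 < q ^ (r - 1) ∧ ((e.1 * q ^ (r - 1) + e.2 * normExp q r : ℕ) : ℤ) ≤ s}

end NormTrace

end

/-! Let `R = K[x, y]` be the affine coordinate ring and `T` the trace polynomial. Since `q = 0` in
`K`, `T' = 1`, so `y` is a root of `T(Y) - x ^ c`, whose derivative is a unit. The identity
"conductor times different = `(f'(y))`", with `f` the minimal polynomial of `y`, then shows that `R`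
is the integral closure of `K[x]` (`adjoin_eq_top_of_isUnit_derivative`). Hence `R` is Dedekind, and
a function integral at every place whose ring contains `R` lies in `R`.

Where `x` has a pole, `c * ord x = q ^ (r - 1) * ord y` with coprime coefficients, so `x ^ i * y ^
j` has pole order `k * (i * q ^ (r - 1) + j * c)` for some `k > 0`. These orders are distinct for `j
< q ^ (r - 1)`, and by the curve equation such monomials span `R`. So the pole order of an element
of `R` is `k` times the largest weight in its expansion. This forces `k = 1`, makes the place
unique, and identifies `L(s Q_∞)` with the span of the monomials of weight at most `s`
(`span_monomial_eq_riemannRoch`).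

At the origin `x` is a uniformizer and `y` has order `c`, so `x ^ i * y ^ j` vanishes to order `i +
j * c`. In the basis `i < q < c`, so these orders are distinct as well, and a combination vanishes
to order `b` exactly when each of its monomials does (`sectionsOfForms_eq_span`). As `b ≤ d < c`,
the monomials that fail are `1, x, …, x ^ (b - 1)`, all of which are in the basis: the codimension
is `b`.

The pull-back of `𝒪(1)` is generated by `y`, of pole order `c`, at `Q_∞` and by `1` elsewhere, so
the sections are `L(s Q_∞ - b Q_0)` (`mem_sectionsOfForms_iff`). -/

namespace NormTrace

open Polynomial WithZero IsDedekindDomain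

/-! ### Places, Dedekind domains and existence of zeros -/

namespace Place

variable {K F : Type*} [Field K] [Field F] [Algebra K F]

theorem val_le_one_iff (P : Place K F) {f : F} : P.val f ≤ 1 ↔ f ∈ P.ring := by
  refine ⟨fun h => ?_, P.val_le_one_of_mem⟩
  have := P.isDVR
  obtain ⟨a, rfl⟩ := IsDiscreteValuationRing.exists_lift_of_le_one (A := P.ring) (K := F) h
  exact a.2

theorem ext_of_val {P Q : Place K F} (h : ∀ f, P.val f ≤ 1 ↔ Q.val f ≤ 1) : P = Q := by
  ext f
  rw [← val_le_one_iff, ← val_le_one_iff, h]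

theorem exists_val_eq_exp_neg_one (P : Place K F) : ∃ f, P.val f = exp (-1 : ℤ) := by
  have := P.isDVR
  exact (IsDiscreteValuationRing.maximalIdeal P.ring).valuation_exists_uniformizer F

theorem val_algebraMap (P : Place K F) {k : K} (hk : k ≠ 0) : P.val (algebraMap K F k) = 1 := by
  refine le_antisymm (P.val_algebraMap_le_one k) ?_
  have h := P.val_algebraMap_le_one k⁻¹
  rw [map_inv₀, map_inv₀] at h
  exact (inv_le_one₀ (zero_lt_iff.2 (by simpa using hk))).1 h

theorem val_smul (P : Place K F) {k : K} (hk : k ≠ 0) (f : F) : P.val (k • f) = P.val f := by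
  rw [Algebra.smul_def, map_mul, P.val_algebraMap hk, one_mul]

theorem ring_ne_top (P : Place K F) : P.ring ≠ ⊤ := by
  intro h
  obtain ⟨f, hf⟩ := P.exists_val_eq_exp_neg_one
  have h1 : P.val f⁻¹ ≤ 1 := P.val_le_one_iff.2 (h ▸ ValuationSubring.mem_top _)
  rw [map_inv₀, hf, ← exp_neg, ← exp_zero, exp_le_exp] at h1
  omega

/-- The ultrametric inequality is an equality when the terms have distinct values. This serves both
at infinity and at the origin. -/
theorem exists_val_linearCombination (P : Place K F) {ι : Type*} (m : ι → F) (l : ι →₀ K)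
    (hl : l ≠ 0) (hinj : Set.InjOn (fun e => P.val (m e)) l.support) :
    ∃ e ∈ l.support, P.val (Finsupp.linearCombination K m l) = P.val (m e) ∧
      ∀ e' ∈ l.support, P.val (m e') ≤ P.val (m e) := by
  classical
  obtain ⟨e, he, hmax⟩ := Finset.exists_max_image l.support (fun e => P.val (m e))
    (Finsupp.support_nonempty_iff.2 hl)
  refine ⟨e, he, ?_, hmax⟩
  rw [Finsupp.linearCombination_apply, Finsupp.sum,
    P.val.map_sum_eq_of_lt he fun i hi => ?_, P.val_smul (Finsupp.mem_support_iff.1 he)]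
  obtain ⟨hi, hie⟩ := Finset.mem_sdiff.1 hi
  rw [P.val_smul (Finsupp.mem_support_iff.1 he), P.val_smul (Finsupp.mem_support_iff.1 hi)]
  exact lt_of_le_of_ne (hmax i hi) fun h => hie (Finset.mem_singleton.2 (hinj hi he h))

section Dedekind

variable {B : Type*} [CommRing B] [IsDedekindDomain B] [Algebra B F] [IsFractionRing B F]

/-- The place of `F` given by a maximal ideal of a Dedekind domain with fraction field `F`. -/
noncomputable def ofHeightOneSpectrum [Algebra K B] [IsScalarTower K B F] (v : HeightOneSpectrum B) :
    Place K F where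
  ring := (v.valuation F).valuationSubring
  algebraMap_mem k := by
    rw [IsScalarTower.algebraMap_apply K B F]
    exact v.valuation_le_one _
  isDVR := by
    rw [← HeightOneSpectrum.valuationSubringAtPrime_eq_valuationSubring]
    exact IsLocalization.AtPrime.isDiscreteValuationRing_of_dedekind_domain B v.ne_bot _

theorem ofHeightOneSpectrum_val_le_one_iff [Algebra K B] [IsScalarTower K B F]
    (v : HeightOneSpectrum B) {f : F} :
    (ofHeightOneSpectrum (K := K) v).val f ≤ 1 ↔ v.valuation F f ≤ 1 :=
  val_le_one_iff _

theorem ofHeightOneSpectrum_val_lt_one [Algebra K B] [IsScalarTower K B F]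
    (v : HeightOneSpectrum B) {b : B} (hb : b ∈ v.asIdeal) :
    (ofHeightOneSpectrum (K := K) v).val (algebraMap B F b) < 1 := by
  have h := (v.valuation_lt_one_iff_mem (K := F) b).2 hb
  by_cases hb0 : algebraMap B F b = 0
  · rw [hb0, map_zero]
    exact zero_lt_one
  have hpos : ∀ v : Valuation F ℤᵐ⁰, 0 < v (algebraMap B F b) := fun v =>
    zero_lt_iff.2 (by simpa using hb0)
  contrapose! h
  have h1 : (ofHeightOneSpectrum (K := K) v).val (algebraMap B F b)⁻¹ ≤ 1 := by
    rw [map_inv₀]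
    exact (inv_le_one₀ (hpos _)).2 h
  rw [ofHeightOneSpectrum_val_le_one_iff, map_inv₀, inv_le_one₀ (hpos _)] at h1
  exact h1

/-- A place whose ring contains `B` and whose maximal ideal contains `v` is the place of `v`. -/
theorem eq_ofHeightOneSpectrum [Algebra K B] [IsScalarTower K B F] (P : Place K F)
    (v : HeightOneSpectrum B) (hB : ∀ b, P.val (algebraMap B F b) ≤ 1)
    (hv : ∀ b ∈ v.asIdeal, P.val (algebraMap B F b) < 1) :
    (∀ d ∉ v.asIdeal, P.val (algebraMap B F d) = 1) ∧ P = ofHeightOneSpectrum v := by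
  have hd : ∀ d ∉ v.asIdeal, P.val (algebraMap B F d) = 1 := by
    intro d hd
    -- Modulo `v` the element `d` has an inverse `e`, so `e * d = 1 - z` with `z ∈ v` has value `1`;
    -- neither factor exceeds `1`, so both equal `1`.
    obtain ⟨e, he⟩ := v.isMaximal.exists_inv hd
    obtain ⟨z, hz, he⟩ := he
    have h1 : P.val (algebraMap B F (e * d)) = 1 := by
      rw [eq_sub_of_add_eq he, map_sub, map_one]
      have := P.val.map_sub_eq_of_lt_right (x := algebraMap B F z) (y := 1) (by simpa using hv z hz)
      rw [P.val.map_sub_swap, this, map_one]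
    rw [map_mul, map_mul] at h1
    exact le_antisymm (hB d) (by rw [← h1]; exact mul_le_of_le_one_left' (hB e))
  refine ⟨hd, ?_⟩
  have hle : v.valuationSubringAtPrime F ≤ P.ring := by
    rw [HeightOneSpectrum.valuationSubringAtPrime_eq_valuationSubring]
    intro f hf
    obtain ⟨n, d, h⟩ := v.exists_primeCompl_mul_eq_of_integer f hf
    rw [← P.val_le_one_iff]
    have := hB n
    rwa [← h, map_mul, hd d d.2, mul_one] at this
  -- A discrete valuation ring has no proper overring other than the whole field.
  have := ValuationSubring.eq_of_le_of_ne_top _ hle P.ring_ne_top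
  ext1
  rw [← this, HeightOneSpectrum.valuationSubringAtPrime_eq_valuationSubring]
  rfl

/-- A Dedekind domain is the intersection of its localizations at the maximal ideals. -/
theorem exists_algebraMap_eq_of_val_le_one [Algebra K B] [IsScalarTower K B F] {f : F}
    (h : ∀ P : Place K F, (∀ b, P.val (algebraMap B F b) ≤ 1) → P.val f ≤ 1) :
    ∃ b, algebraMap B F b = f := by
  refine HeightOneSpectrum.mem_integers_of_valuation_le_one F f fun v => ?_
  rw [← ofHeightOneSpectrum_val_le_one_iff (K := K)]
  exact h _ fun b => (ofHeightOneSpectrum_val_le_one_iff v).2 (v.valuation_le_one b)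

end Dedekind

/-- A nonunit of `A` stays a nonunit in the integral extension `B`, hence lies in a maximal ideal of
the Dedekind domain `B`, which is a place. -/
theorem exists_val_lt_one_of_not_isUnit (A E B : Type*) [CommRing A] [IsDedekindDomain A]
    [Algebra A F] [Field E] [Algebra A E] [IsFractionRing A E] [Algebra E F]
    [IsScalarTower A E F] [FiniteDimensional E F] [Algebra.IsSeparable E F] [Algebra K A]
    [IsScalarTower K A F] [CommRing B] [IsDomain B] [Algebra A B] [Algebra B F]
    [IsScalarTower A B F] [IsIntegralClosure B A F] {a : A} (ha : ¬ IsUnit a) (ha0 : a ≠ 0) :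
    ∃ P : Place K F, P.val (algebraMap A F a) < 1 := by
  have := IsIntegralClosure.isDedekindDomain A E F B
  have := IsIntegralClosure.isFractionRing_of_finite_extension A E F B
  have : Algebra.IsIntegral A B := IsIntegralClosure.isIntegral_algebra A F
  have hinj : Function.Injective (algebraMap A B) := by
    have := (FaithfulSMul.algebraMap_injective E F).comp (IsFractionRing.injective A E)
    rw [← RingHom.coe_comp, ← IsScalarTower.algebraMap_eq, IsScalarTower.algebraMap_eq A B F,
      RingHom.coe_comp] at this
    exact this.of_comp
  have : FaithfulSMul A B := (faithfulSMul_iff_algebraMap_injective _ _).2 hinj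
  let _ : Algebra K B := ((algebraMap A B).comp (algebraMap K A)).toAlgebra
  have : IsScalarTower K B F := IsScalarTower.of_algebraMap_eq fun k => by
    rw [RingHom.algebraMap_toAlgebra, RingHom.comp_apply, ← IsScalarTower.algebraMap_apply A B F,
      ← IsScalarTower.algebraMap_apply K A F]
  obtain ⟨M, hM, haM⟩ := exists_max_ideal_of_mem_nonunits
    (mt (isUnit_map_iff (algebraMap A B) a).1 ha)
  have hM0 : M ≠ ⊥ := by
    rintro rfl
    exact ha0 (hinj ((Ideal.mem_bot.1 haM).trans (map_zero _).symm))
  refine ⟨ofHeightOneSpectrum (K := K) ⟨M, hM.isPrime, hM0⟩, ?_⟩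
  rw [IsScalarTower.algebraMap_apply A B F]
  exact ofHeightOneSpectrum_val_lt_one _ haM

open scoped IntermediateField IntermediateField.algebraAdjoinAdjoin

instance isPrincipalIdealRing_adjoin (t : F) : IsPrincipalIdealRing (Algebra.adjoin K {t}) := by
  rw [Algebra.adjoin_singleton_eq_range_aeval]
  exact IsPrincipalIdealRing.of_surjective (aeval (R := K) t).rangeRestrict
    (AlgHom.rangeRestrict_surjective _)

theorem exists_val_lt_one_of_transcendental (t : F) [FiniteDimensional K⟮t⟯ F]
    [Algebra.IsSeparable K⟮t⟯ F] (ht : Transcendental K t) : ∃ P : Place K F, P.val t < 1 := by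
  refine exists_val_lt_one_of_not_isUnit (Algebra.adjoin K {t}) K⟮t⟯
    (integralClosure (Algebra.adjoin K {t}) F)
    (a := ⟨t, Algebra.self_mem_adjoin_singleton K t⟩) (fun h => ?_) (fun h => ?_)
  · obtain ⟨⟨b, hb'⟩, hb⟩ := h.exists_right_inv
    rw [Algebra.adjoin_singleton_eq_range_aeval] at hb'
    obtain ⟨p, rfl⟩ := hb'
    have h1 : aeval t (X * p - 1 : K[X]) = 0 := by
      rw [map_sub, map_mul, aeval_X, map_one, sub_eq_zero]
      exact congrArg Subtype.val hb
    -- If `t` were a unit in `K[t]`, then `X * p - 1` would be the zero polynomial, but its value at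
    -- `0` is `-1`.
    have := congrArg (eval 0) (transcendental_iff.1 ht _ h1)
    simp at this
  · have : t = 0 := congrArg Subtype.val h
    exact ht (this ▸ isAlgebraic_zero)

end Place

/-- Write `T = f * g` with `f` the minimal polynomial of `b`. Then `T'(b) = f'(b) * g(b)`, so
`f'(b)` is a unit; it generates the product of the conductor and the different, so the conductor is
the unit ideal. -/
theorem adjoin_eq_top_of_isUnit_derivative (A E L B : Type*) [CommRing A] [IsDedekindDomain A]
    [Field E] [Algebra A E] [IsFractionRing A E] [Field L] [Algebra E L] [Algebra A L]
    [IsScalarTower A E L] [FiniteDimensional E L] [Algebra.IsSeparable E L] [CommRing B]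
    [IsDomain B] [Algebra A B] [Algebra B L] [IsScalarTower A B L] [IsIntegralClosure B A L]
    (b : B) (hb : Algebra.adjoin E {algebraMap B L b} = ⊤) {T : A[X]} (hT : aeval b T = 0)
    (hu : IsUnit (aeval b (derivative T))) : Algebra.adjoin A {b} = ⊤ := by
  have := IsIntegralClosure.isDedekindDomain A E L B
  have : Module.IsTorsionFree A B := by
    have := (FaithfulSMul.algebraMap_injective E L).comp (IsFractionRing.injective A E)
    rw [← RingHom.coe_comp, ← IsScalarTower.algebraMap_eq, IsScalarTower.algebraMap_eq A B L,
      RingHom.coe_comp] at this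
    have : FaithfulSMul A B := (faithfulSMul_iff_algebraMap_injective _ _).2 this.of_comp
    infer_instance
  have hbi : IsIntegral A b := IsIntegralClosure.isIntegral A L b
  obtain ⟨g, rfl⟩ := minpoly.isIntegrallyClosed_dvd hbi hT
  rw [derivative_mul, map_add, map_mul, map_mul, minpoly.aeval, zero_mul, add_zero] at hu
  have h := conductor_mul_differentIdeal A E L b hb
  rw [Ideal.span_singleton_eq_top.2 (isUnit_of_mul_isUnit_left hu)] at h
  exact conductor_eq_top_iff_adjoin_eq_top.1 (top_le_iff.1 (h ▸ Ideal.mul_le_left))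

/-! ### Arithmetic of `c` and the trace polynomial -/

section Arithmetic

theorem normExp_eq_geomSum {q : ℕ} (hq : 2 ≤ q) (r : ℕ) :
    normExp q r = ∑ i ∈ Finset.range r, q ^ i := by
  rw [normExp, Nat.geomSum_eq hq]

theorem lt_normExp {q r : ℕ} (hq : 2 ≤ q) (hr : 2 ≤ r) : q ^ (r - 1) < normExp q r := by
  obtain ⟨n, rfl⟩ := Nat.exists_eq_add_of_le hr
  rw [normExp_eq_geomSum hq, show 2 + n = (n + 1) + 1 by omega, Finset.sum_range_succ,
    Finset.sum_range_succ']
  simp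

theorem self_lt_normExp {q r : ℕ} (hq : 2 ≤ q) (hr : 2 ≤ r) : q < normExp q r :=
  (Nat.le_self_pow (by omega) q).trans_lt (lt_normExp hq hr)

theorem sub_one_mul_normExp {q : ℕ} (hq : 2 ≤ q) (r : ℕ) : (q - 1) * normExp q r = q ^ r - 1 := by
  rw [normExp_eq_geomSum hq, Nat.geomSum_eq hq]
  exact Nat.mul_div_cancel' (Nat.sub_one_dvd_pow_sub_one q r)

theorem coprime_normExp {q r : ℕ} (hq : 2 ≤ q) (hr : 2 ≤ r) :
    (normExp q r).Coprime (q ^ (r - 1)) := by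
  refine Nat.Coprime.pow_right _ ?_
  obtain ⟨n, rfl⟩ := Nat.exists_eq_add_of_le' (by omega : 1 ≤ r)
  rw [normExp_eq_geomSum hq, Finset.sum_range_succ']
  simp only [pow_succ, ← Finset.sum_mul, pow_zero]
  simp

end Arithmetic

section TracePoly

variable (q r : ℕ) (K : Type*) [Field K]

theorem aeval_tracePoly {F : Type*} [CommRing F] [Algebra K F] (f : F) :
    aeval f (tracePoly q r K) = ∑ i ∈ Finset.range r, f ^ q ^ i := by
  simp [tracePoly]

theorem derivative_tracePoly (hr : 1 ≤ r) (hq : (q : K) = 0) : derivative (tracePoly q r K) = 1 := by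
  rw [tracePoly, derivative_sum, Finset.sum_eq_single 0]
  · simp
  · intro i _ hi
    rw [derivative_X_pow, Nat.cast_pow, hq, zero_pow hi, map_zero, zero_mul]
  · intro h
    exact absurd (Finset.mem_range.2 (by omega)) h

end TracePoly

/-- Transitivity of integrality with no `A`-algebra structure on `R`: only the image of `R` in `F`
matters. -/
theorem isIntegral_of_forall_isIntegral_algebraMap {A R F : Type*} [CommRing A] [CommRing R]
    [CommRing F] [Algebra A F] [Algebra R F] (h : ∀ b : R, IsIntegral A (algebraMap R F b)) {f : F}
    (hf : IsIntegral R f) : IsIntegral A f := by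
  have hf' : IsIntegral (integralClosure A F) f := by
    obtain ⟨p, hp, hp0⟩ := hf
    refine ⟨p.map ((algebraMap R F).codRestrict (integralClosure A F) h), hp.map _, ?_⟩
    rw [eval₂_map]
    exact hp0
  exact isIntegral_trans (A := integralClosure A F) f hf'

/-! ### The extension `K(x, y) / K(x)` when `T(y) = x ^ n` and `T' = 1` -/

section SimpleExtension

open scoped IntermediateField IntermediateField.algebraAdjoinAdjoin

variable {K F : Type*} [Field K] [Field F] [Algebra K F] {x y : F}

theorem aeval_map_sub_C_eq_zero {T : K[X]} {n : ℕ} (hT : aeval y T = x ^ n) (A : Type*) [CommRing A]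
    [Algebra K A] [Algebra A F] [IsScalarTower K A F] {a : A} (ha : algebraMap A F a = x) :
    aeval y (T.map (algebraMap K A) - C (a ^ n)) = 0 := by
  rw [map_sub, aeval_map_algebraMap, aeval_C, map_pow, ha, hT, sub_self]

theorem derivative_map_sub_C {T : K[X]} (hT' : derivative T = 1) {A : Type*} [CommRing A]
    [Algebra K A] (a : A) : derivative (T.map (algebraMap K A) - C a) = 1 := by
  rw [derivative_sub, derivative_C, sub_zero, derivative_map, hT', Polynomial.map_one]

theorem isSeparable_of_aeval_eq {T : K[X]} {n : ℕ} (hT : aeval y T = x ^ n)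
    (hT' : derivative T = 1) (E : Type*) [Field E] [Algebra K E] [Algebra E F] [IsScalarTower K E F]
    {e : E} (he : algebraMap E F e = x) : IsSeparable E y := by
  have hsep : (T.map (algebraMap K E) - C (e ^ n)).Separable := by
    rw [Separable, derivative_map_sub_C hT']
    exact isCoprime_one_right
  exact hsep.of_dvd (minpoly.dvd _ _ (aeval_map_sub_C_eq_zero hT _ he))

theorem finiteDimensional_adjoin_of_isSeparable (hxy : K⟮x⟯⟮y⟯ = ⊤) (h : IsSeparable K⟮x⟯ y) :
    FiniteDimensional K⟮x⟯ F := by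
  have := IntermediateField.adjoin.finiteDimensional h.isIntegral
  rw [hxy] at this
  exact Module.Finite.equiv (IntermediateField.topEquiv (F := K⟮x⟯) (E := F)).toLinearEquiv

theorem algebra_isSeparable_adjoin_of_isSeparable (hxy : K⟮x⟯⟮y⟯ = ⊤) (h : IsSeparable K⟮x⟯ y) :
    Algebra.IsSeparable K⟮x⟯ F := by
  have := (IntermediateField.isSeparable_adjoin_simple_iff_isSeparable _ _).2 h
  rw [hxy] at this
  exact AlgEquiv.Algebra.isSeparable (IntermediateField.topEquiv (F := K⟮x⟯) (E := F))

/-- A pole of `x` is a zero of `x⁻¹`, and `K(x⁻¹) = K(x)`. -/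
theorem exists_one_lt_val (hx : Transcendental K x) (hxy : K⟮x⟯⟮y⟯ = ⊤) (h : IsSeparable K⟮x⟯ y) :
    ∃ P : Place K F, 1 < P.val x := by
  have hE : K⟮x⁻¹⟯ = K⟮x⟯ := by
    refine le_antisymm ?_ ?_ <;> rw [IntermediateField.adjoin_simple_le_iff]
    · exact inv_mem (IntermediateField.mem_adjoin_simple_self _ _)
    · rw [← inv_mem_iff]
      exact IntermediateField.mem_adjoin_simple_self _ _
  have hfin : FiniteDimensional K⟮x⁻¹⟯ F := by
    rw [hE]
    exact finiteDimensional_adjoin_of_isSeparable hxy h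
  have hsep : Algebra.IsSeparable K⟮x⁻¹⟯ F := by
    rw [hE]
    exact algebra_isSeparable_adjoin_of_isSeparable hxy h
  have ht : Transcendental K x⁻¹ := fun h => hx (by simpa using h.inv)
  obtain ⟨P, hP⟩ := Place.exists_val_lt_one_of_transcendental _ ht
  refine ⟨P, ?_⟩
  rw [map_inv₀] at hP
  refine (inv_lt_one₀ (zero_lt_iff.2 ?_)).1 hP
  rw [Valuation.ne_zero_iff]
  rintro rfl
  exact hx isAlgebraic_zero

theorem adjoin_eq_top_of_derivative_eq_one {T : K[X]} {n : ℕ} (hT : aeval y T = x ^ n)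
    (hT' : derivative T = 1) (hxy : K⟮x⟯⟮y⟯ = ⊤) (B : Type*) [CommRing B]
    [IsDomain B] [Algebra (Algebra.adjoin K {x}) B] [Algebra B F]
    [IsScalarTower (Algebra.adjoin K {x}) B F] [IsIntegralClosure B (Algebra.adjoin K {x}) F]
    {b : B} (hb : algebraMap B F b = y) : Algebra.adjoin (Algebra.adjoin K {x}) {b} = ⊤ := by
  have hs := isSeparable_of_aeval_eq hT hT' K⟮x⟯
    (e := IntermediateField.AdjoinSimple.gen K x) rfl
  have := finiteDimensional_adjoin_of_isSeparable hxy hs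
  have := algebra_isSeparable_adjoin_of_isSeparable hxy hs
  have hE : Algebra.adjoin K⟮x⟯ {algebraMap B F b} = ⊤ := by
    rw [hb, ← IntermediateField.adjoin_simple_toSubalgebra_of_isAlgebraic
      hs.isIntegral.isAlgebraic, hxy, IntermediateField.top_toSubalgebra]
  have h0 := aeval_map_sub_C_eq_zero hT (Algebra.adjoin K {x})
    (a := ⟨x, Algebra.self_mem_adjoin_singleton _ _⟩) rfl
  rw [← hb, aeval_algebraMap_apply,
    map_eq_zero_iff _ (IsIntegralClosure.algebraMap_injective B (Algebra.adjoin K {x}) F)] at h0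
  refine adjoin_eq_top_of_isUnit_derivative _ K⟮x⟯ F B b hE h0 ?_
  rw [derivative_map_sub_C hT', map_one]
  exact isUnit_one

theorem isIntegral_adjoin_of_aeval_eq {T : K[X]} {n : ℕ} (hT : aeval y T = x ^ n)
    (hmonic : T.Monic) (hdeg : T.natDegree ≠ 0) : IsIntegral (Algebra.adjoin K {x}) y := by
  have h1 : IsIntegral (Algebra.adjoin K {x}) (aeval y (T.map (algebraMap K (Algebra.adjoin K {x})))) := by
    rw [aeval_map_algebraMap, hT]
    exact (isIntegral_algebraMap (x := (⟨x, Algebra.self_mem_adjoin_singleton _ _⟩ :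
      Algebra.adjoin K {x}))).pow n
  exact h1.of_aeval_monic (hmonic.map _) (by rwa [hmonic.natDegree_map])

theorem mem_adjoin_of_isIntegral_of_derivative_eq_one {T : K[X]} {n : ℕ} (hT : aeval y T = x ^ n)
    (hT' : derivative T = 1) (hmonic : T.Monic) (hdeg : T.natDegree ≠ 0) (hxy : K⟮x⟯⟮y⟯ = ⊤) {f : F}
    (hf : IsIntegral (Algebra.adjoin K {x}) f) : f ∈ Algebra.adjoin K {x, y} := by
  set A := Algebra.adjoin K {x} with hA
  have hy : IsIntegral A y := isIntegral_adjoin_of_aeval_eq hT hmonic hdeg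
  have htop := adjoin_eq_top_of_derivative_eq_one hT hT' hxy (integralClosure A F)
    (b := ⟨y, hy⟩) rfl
  have hmem : (⟨f, hf⟩ : integralClosure A F) ∈ Algebra.adjoin A {⟨y, hy⟩} := by
    rw [htop]
    trivial
  have h2 : f ∈ Algebra.adjoin A {y} := by
    have := (Subalgebra.mem_map (f := (integralClosure A F).val)).2 ⟨_, hmem, rfl⟩
    rwa [AlgHom.map_adjoin_singleton] at this
  rw [Set.insert_eq, Algebra.adjoin_union_eq_adjoin_adjoin]
  exact h2

end SimpleExtension

/-! ### The function field and the coordinate ring of the curve -/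

section Curve

variable (q r : ℕ) (K : Type*) [Field K]

theorem x_pow_normExp :
    x q r K ^ normExp q r = ∑ i ∈ Finset.range r, y q r K ^ q ^ i := by
  have h : aeval (AdjoinRoot.root (curvePoly q r K)) (curvePoly q r K) = 0 := AdjoinRoot.eval₂_root _
  conv at h =>
    arg 1
    arg 2
    rw [curvePoly]
  rw [map_sub, map_pow, aeval_X, aeval_C, sub_eq_zero] at h
  have h2 := congrArg (algebraMap (CoordRing q r K) (FunctionField q r K)) h
  rw [map_pow] at h2
  refine h2.trans ?_
  simp only [tracePoly, y, AdjoinRoot.algebraMap_eq, map_sum, map_pow]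

theorem aeval_y_tracePoly : aeval (y q r K) (tracePoly q r K) = x q r K ^ normExp q r := by
  rw [aeval_tracePoly, x_pow_normExp]

theorem adjoin_root_of_X :
    Algebra.adjoin K {AdjoinRoot.root (curvePoly q r K), AdjoinRoot.of (curvePoly q r K) X} = ⊤ := by
  refine top_le_iff.1 fun f _ => ?_
  set S := Algebra.adjoin K {AdjoinRoot.root (curvePoly q r K), AdjoinRoot.of (curvePoly q r K) X}
  have hx : AdjoinRoot.root (curvePoly q r K) ∈ S := Algebra.subset_adjoin (by simp)
  have hy : AdjoinRoot.of (curvePoly q r K) X ∈ S := Algebra.subset_adjoin (by simp)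
  have hK : ∀ p : K[X], AdjoinRoot.of (curvePoly q r K) p ∈ S := by
    intro p
    induction p using Polynomial.induction_on' with
    | add p p' h h' => rw [map_add]; exact add_mem h h'
    | monomial n k =>
      rw [← C_mul_X_pow_eq_monomial, map_mul, map_pow]
      exact mul_mem (S.algebraMap_mem k) (pow_mem hy n)
  induction f using AdjoinRoot.induction_on with
  | ih p =>
    induction p using Polynomial.induction_on' with
    | add p p' h h' => rw [map_add]; exact add_mem (h trivial) (h' trivial)
    | monomial n k =>
      rw [← C_mul_X_pow_eq_monomial, map_mul, map_pow]
      exact mul_mem (hK k) (pow_mem hx n)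

/-- To prove a property of all regular functions, it is enough to do so for constants and for
the two coordinates, and to check that it is stable under sums and products. -/
theorem coordRing_induction {p : CoordRing q r K → Prop}
    (algebraMap : ∀ k, p (algebraMap K _ k)) (root : p (AdjoinRoot.root _))
    (of_X : p (AdjoinRoot.of _ X)) (add : ∀ f g, p f → p g → p (f + g))
    (mul : ∀ f g, p f → p g → p (f * g)) (f : CoordRing q r K) : p f := by
  have hf : f ∈ Algebra.adjoin K
      {AdjoinRoot.root (curvePoly q r K), AdjoinRoot.of (curvePoly q r K) X} := by
    rw [adjoin_root_of_X]
    trivial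
  induction hf using Algebra.adjoin_induction with
  | mem f hf =>
    obtain rfl | rfl := hf
    exacts [root, of_X]
  | algebraMap k => exact algebraMap k
  | add f g _ _ h h' => exact add f g h h'
  | mul f g _ _ h h' => exact mul f g h h'

variable [hq : Fact (IsPrimePow q)] [hr : Fact (2 ≤ r)]

theorem transcendental_y : Transcendental K (y q r K) := by
  rw [transcendental_iff]
  intro p hp
  have h : aeval (y q r K) p = algebraMap _ _ (AdjoinRoot.of (curvePoly q r K) p) := by
    have h1 : AdjoinRoot.of (curvePoly q r K) p = aeval (AdjoinRoot.of (curvePoly q r K) X) p := by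
      conv_lhs => rw [← aeval_X_left_apply p]
      exact (aeval_algHom_apply (Algebra.ofId K[X] (CoordRing q r K) |>.restrictScalars K) X p).symm
    rw [h1, y, aeval_algebraMap_apply]
  rw [h, map_eq_zero_iff _ (IsFractionRing.injective _ _)] at hp
  have hdeg : (curvePoly q r K).degree ≠ 0 := by
    have hc := normExp_pos hq.out.two_le (one_le_two.trans hr.out)
    rw [curvePoly, degree_X_pow_sub_C hc]
    exact_mod_cast hc.ne'
  exact (map_eq_zero_iff _ (AdjoinRoot.of.injective_of_degree_ne_zero hdeg)).1 hp

theorem natDegree_tracePoly_ne_zero : (tracePoly q r K).natDegree ≠ 0 := by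
  have hq2 := hq.out.two_le
  have h2 := hr.out
  intro h
  have hc : (tracePoly q r K).coeff q = 1 := by
    rw [tracePoly, finsetSum_coeff, Finset.sum_eq_single 1]
    · simp
    · intro i _ hi
      rw [coeff_X_pow, if_neg]
      intro h
      exact hi (Nat.pow_right_injective hq2 (by simpa using h.symm))
    · intro h
      exact absurd (Finset.mem_range.2 (by omega)) h
  rw [coeff_eq_zero_of_natDegree_lt (by omega)] at hc
  exact zero_ne_one hc

/-- Otherwise the nonconstant polynomial value `T(y) = x ^ c` would be algebraic, and so would `y`.
-/
theorem transcendental_x : Transcendental K (x q r K) := by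
  intro h
  have h1 := h.pow (normExp q r)
  rw [← aeval_y_tracePoly] at h1
  refine transcendental_y q r K (h1.of_aeval_of_transcendental ?_)
  refine Polynomial.transcendental _ (natDegree_tracePoly_ne_zero q r K) ?_
  rw [mem_nonZeroDivisors_iff_ne_zero, leadingCoeff_ne_zero]
  rintro h
  exact natDegree_tracePoly_ne_zero q r K (by rw [h, natDegree_zero])

open scoped IntermediateField IntermediateField.algebraAdjoinAdjoin

theorem adjoin_y_eq_top : K⟮x q r K⟯⟮y q r K⟯ = ⊤ := by
  have hR : ∀ f : CoordRing q r K,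
      algebraMap _ (FunctionField q r K) f ∈ K⟮x q r K⟯⟮y q r K⟯ := by
    intro f
    induction f using coordRing_induction with
    | algebraMap k =>
      exact (K⟮x q r K⟯⟮y q r K⟯).algebraMap_mem (algebraMap K K⟮x q r K⟯ k)
    | root =>
      exact (K⟮x q r K⟯⟮y q r K⟯).algebraMap_mem (IntermediateField.AdjoinSimple.gen K (x q r K))
    | of_X => exact IntermediateField.mem_adjoin_simple_self _ _
    | add f g h h' => rw [map_add]; exact add_mem h h'
    | mul f g h h' => rw [map_mul]; exact mul_mem h h'
  refine top_le_iff.1 fun f _ => ?_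
  obtain ⟨a, b, _, rfl⟩ := IsFractionRing.div_surjective (A := CoordRing q r K) f
  exact div_mem (hR a) (hR b)

end Curve

theorem monic_tracePoly {q r : ℕ} (K : Type*) [Field K] (hq : 2 ≤ q) (hr : 1 ≤ r) :
    (tracePoly q r K).Monic := by
  obtain ⟨n, rfl⟩ := Nat.exists_eq_add_of_le' hr
  rw [tracePoly, Finset.sum_range_succ, add_comm]
  refine monic_X_pow_add (mem_degreeLT.1 (Submodule.sum_mem _ fun i hi => ?_))
  rw [mem_degreeLT, degree_X_pow]
  exact_mod_cast Nat.pow_lt_pow_right hq (Finset.mem_range.1 hi)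

section Curve

variable (q r : ℕ) (K : Type*) [Field K]

theorem algebraMap_mem_adjoin (f : CoordRing q r K) :
    algebraMap _ (FunctionField q r K) f ∈ Algebra.adjoin K {x q r K, y q r K} := by
  induction f using coordRing_induction with
  | algebraMap k => exact Subalgebra.algebraMap_mem _ k
  | root => exact Algebra.subset_adjoin (by simp [x])
  | of_X => exact Algebra.subset_adjoin (by simp [y])
  | add f g h h' => rw [map_add]; exact add_mem h h'
  | mul f g h h' => rw [map_mul]; exact mul_mem h h'

theorem exists_algebraMap_eq_of_mem_adjoin {f : FunctionField q r K}
    (hf : f ∈ Algebra.adjoin K {x q r K, y q r K}) : ∃ g : CoordRing q r K, algebraMap _ _ g = f := by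
  have : Algebra.adjoin K {x q r K, y q r K} ≤
      (IsScalarTower.toAlgHom K (CoordRing q r K) (FunctionField q r K)).range := by
    rw [Algebra.adjoin_le_iff]
    rintro _ (rfl | rfl)
    exacts [⟨_, rfl⟩, ⟨_, rfl⟩]
  exact this hf

variable [hq : Fact (IsPrimePow q)] [hr : Fact (2 ≤ r)]

theorem exists_algebraMap_eq_of_isIntegral (hK : (q : K) = 0) {f : FunctionField q r K}
    (hf : IsIntegral (Algebra.adjoin K {x q r K}) f) :
    ∃ g : CoordRing q r K, algebraMap _ _ g = f := by
  have hr1 := one_le_two.trans hr.out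
  exact exists_algebraMap_eq_of_mem_adjoin q r K
    (mem_adjoin_of_isIntegral_of_derivative_eq_one (aeval_y_tracePoly q r K)
    (derivative_tracePoly q r K hr1 hK) (monic_tracePoly K hq.out.two_le hr1)
    (natDegree_tracePoly_ne_zero q r K) (adjoin_y_eq_top q r K) hf)

theorem isIntegral_y : IsIntegral (Algebra.adjoin K {x q r K}) (y q r K) :=
  isIntegral_adjoin_of_aeval_eq (aeval_y_tracePoly q r K)
    (monic_tracePoly K hq.out.two_le (one_le_two.trans hr.out))
    (natDegree_tracePoly_ne_zero q r K)

theorem isIntegral_algebraMap_coordRing (f : CoordRing q r K) :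
    IsIntegral (Algebra.adjoin K {x q r K}) (algebraMap _ (FunctionField q r K) f) := by
  induction f using coordRing_induction with
  | algebraMap k => exact isIntegral_algebraMap (x := algebraMap K (Algebra.adjoin K {x q r K}) k)
  | root => exact isIntegral_algebraMap (x := (⟨x q r K, Algebra.self_mem_adjoin_singleton _ _⟩ :
      Algebra.adjoin K {x q r K}))
  | of_X => exact isIntegral_y q r K
  | add f g h h' => rw [map_add]; exact h.add h'
  | mul f g h h' => rw [map_mul]; exact h.mul h'

/-- Two base rings play a role: finiteness over `K[Y]` bounds the dimension, while integral
closedness is read off over `K[x]`, where `y` satisfies an equation with unit derivative. -/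
theorem isDedekindDomain_coordRing (hK : (q : K) = 0) : IsDedekindDomain (CoordRing q r K) := by
  have hm : (curvePoly q r K).Monic :=
    monic_X_pow_sub_C _ (normExp_pos hq.out.two_le (one_le_two.trans hr.out)).ne'
  have : Module.Finite K[X] (CoordRing q r K) := hm.finite_adjoinRoot
  refine (isDedekindDomain_iff _ (FunctionField q r K)).2 ⟨inferInstance,
    inferInstance, Ring.DimensionLEOne.of_isIntegral K[X] _,
    fun hf => exists_algebraMap_eq_of_isIntegral q r K hK
      (isIntegral_of_forall_isIntegral_algebraMap (isIntegral_algebraMap_coordRing q r K) hf)⟩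

/-- Evaluation at the origin. -/
noncomputable def evalZero : CoordRing q r K →+* K :=
  AdjoinRoot.lift (evalRingHom 0) 0 (by
    have h1 := normExp_pos hq.out.two_le (one_le_two.trans hr.out)
    have h2 : (tracePoly q r K).eval 0 = 0 := by
      rw [tracePoly, eval_finsetSum]
      refine Finset.sum_eq_zero fun i _ => ?_
      rw [eval_pow, eval_X, zero_pow (pow_pos (by have := hq.out.two_le; omega) i).ne']
    simp [curvePoly, h1.ne', h2])

end Curve

/-! ### Places over `(0 : 1 : 0)` and over the origin -/

namespace Place

variable {q r : ℕ} {K : Type*} [Field K] [hq : Fact (IsPrimePow q)] [hr : Fact (2 ≤ r)]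
  (P : Place K (FunctionField q r K))

/-- The top power of `y` dominates the trace here; when `|y| < 1`, the linear term does. -/
theorem val_x_pow_of_one_lt (hy : 1 < P.val (y q r K)) :
    P.val (x q r K) ^ normExp q r = P.val (y q r K) ^ q ^ (r - 1) := by
  have h2 := hr.out
  rw [← map_pow, x_pow_normExp, P.val.map_sum_eq_of_lt (j := r - 1)
    (Finset.mem_range.2 (by omega)), map_pow]
  intro i hi
  simp only [Finset.mem_sdiff, Finset.mem_range, Finset.mem_singleton] at hi
  rw [map_pow, map_pow]
  exact pow_lt_pow_right₀ hy (Nat.pow_lt_pow_right hq.out.two_le (by omega))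

theorem val_x_pow_of_lt_one (hy : P.val (y q r K) < 1) :
    P.val (x q r K) ^ normExp q r = P.val (y q r K) := by
  have h2 := hr.out
  have hy0 : 0 < P.val (y q r K) := by
    rw [zero_lt_iff, Valuation.ne_zero_iff]
    intro h
    exact transcendental_y q r K (h ▸ isAlgebraic_zero)
  rw [← map_pow, x_pow_normExp, P.val.map_sum_eq_of_lt (j := 0)
    (Finset.mem_range.2 (by omega)), pow_zero, pow_one]
  intro i hi
  simp only [Finset.mem_sdiff, Finset.mem_singleton] at hi
  rw [map_pow, map_pow]
  exact pow_lt_pow_right_of_lt_one₀ hy0 hy (Nat.pow_lt_pow_right hq.out.two_le (by omega))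

theorem val_x_le_one (hy : P.val (y q r K) ≤ 1) : P.val (x q r K) ≤ 1 := by
  have hc := normExp_pos hq.out.two_le (one_le_two.trans hr.out)
  rw [← pow_le_one_iff_of_nonneg zero_le hc.ne', ← map_pow, x_pow_normExp]
  refine P.val.map_sum_le fun i _ => ?_
  rw [map_pow]
  exact pow_le_one₀ zero_le hy

theorem one_lt_val_y (hx : 1 < P.val (x q r K)) : 1 < P.val (y q r K) :=
  lt_of_not_ge fun h => hx.not_ge (P.val_x_le_one h)

theorem val_y_le_one (hx : P.val (x q r K) ≤ 1) : P.val (y q r K) ≤ 1 := by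
  by_contra! h
  have h1 := P.val_x_pow_of_one_lt h
  have h2 := one_lt_pow₀ h (pow_pos (by have := hq.out.two_le; omega : 0 < q) (r - 1)).ne'
  rw [← h1] at h2
  exact h2.not_ge (pow_le_one₀ zero_le hx)

theorem val_x_lt_val_y (hx : 1 < P.val (x q r K)) : P.val (x q r K) < P.val (y q r K) := by
  by_contra! h
  have h1 := P.val_x_pow_of_one_lt (P.one_lt_val_y hx)
  have h2 := pow_le_pow_left₀ zero_le h (q ^ (r - 1))
  rw [← h1] at h2
  exact h2.not_gt (pow_lt_pow_right₀ hx (lt_normExp hq.out.two_le hr.out))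

theorem val_x_lt_one (hy : P.val (y q r K) < 1) : P.val (x q r K) < 1 := by
  have h1 := P.val_x_pow_of_lt_one hy
  by_contra! h
  exact hy.not_ge (h1 ▸ one_le_pow₀ h)

theorem liesOver_infinity_iff :
    P.LiesOver (coords q r K) ![0, 1, 0] ↔ 1 < P.val (x q r K) := by
  constructor
  · intro h
    -- This minor is the constant `1`, so some coordinate has absolute value greater than `1`.
    have h2 := h 1 2
    simp [coords, height] at h2
    have hy : 1 < P.val (y q r K) := by
      rcases le_or_gt (P.val (x q r K)) 1 with hx | hx
      exacts [h2 hx, P.one_lt_val_y hx]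
    have := one_lt_pow₀ hy (pow_pos (by have := hq.out.two_le; omega : 0 < q) (r - 1)).ne'
    rw [← P.val_x_pow_of_one_lt hy] at this
    exact (one_lt_pow_iff_of_nonneg zero_le
      (normExp_pos hq.out.two_le (one_le_two.trans hr.out)).ne').1 this
  · intro hx i j
    have h1 := P.one_lt_val_y hx
    have h2 := P.val_x_lt_val_y hx
    fin_cases i <;> fin_cases j <;> simp [coords, height, h1, h2]

theorem liesOver_origin_iff :
    P.LiesOver (coords q r K) ![0, 0, 1] ↔ P.val (y q r K) < 1 := by
  constructor
  · intro h
    -- These two minors are, up to sign, `x` and `y`; both lie strictly below the height, so the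
    -- third coordinate `1` attains it.
    have h1 := h 2 0
    have h2 := h 2 1
    simp [coords, height] at h1 h2
    rcases h2 with h2 | h2
    · rcases h1 with h1 | h1
      · exact absurd h1 h2.not_gt
      · exact h2.trans h1
    · exact h2
  · intro hy i j
    have hx := P.val_x_lt_one hy
    fin_cases i <;> fin_cases j <;> simp [coords, height, hx, hy]

theorem val_algebraMap_coordRing_le_one (hx : P.val (x q r K) ≤ 1) (f : CoordRing q r K) :
    P.val (algebraMap _ _ f) ≤ 1 := by
  induction f using coordRing_induction with
  | algebraMap k => exact P.val_algebraMap_le_one k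
  | root => exact hx
  | of_X => exact P.val_y_le_one hx
  | add f g h h' => rw [map_add]; exact (P.val.map_add _ _).trans (max_le h h')
  | mul f g h h' => rw [map_mul, map_mul]; exact mul_le_one' h h'

/-- Near the origin `|y| = |x| ^ c ≤ |x|`, so every regular function vanishing there is at most
`|x|`. This is what makes `x` a uniformizer. -/
theorem val_algebraMap_sub_evalZero_le (hy : P.val (y q r K) < 1) (f : CoordRing q r K) :
    P.val (algebraMap _ _ f - algebraMap K _ (evalZero q r K f)) ≤ P.val (x q r K) := by
  have hx := P.val_x_lt_one hy
  have hc := normExp_pos hq.out.two_le (one_le_two.trans hr.out)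
  induction f using coordRing_induction with
  | algebraMap k =>
    rw [show evalZero q r K (algebraMap K _ k) = k by
      simp [evalZero, AdjoinRoot.algebraMap_eq'], ← IsScalarTower.algebraMap_apply, sub_self,
      map_zero]
    exact zero_le
  | root => simp [evalZero, x]
  | of_X =>
    have : evalZero q r K (AdjoinRoot.of _ X) = 0 := by simp [evalZero]
    rw [this, map_zero, sub_zero]
    refine (P.val_x_pow_of_lt_one hy).symm.le.trans (pow_le_of_le_one zero_le hx.le hc.ne')
  | add f g h h' =>
    rw [map_add, map_add, map_add, add_sub_add_comm]
    exact (P.val.map_add _ _).trans (max_le h h')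
  | mul f g h h' =>
    rw [map_mul, map_mul, map_mul, show ∀ a b c d : FunctionField q r K,
      a * b - c * d = (a - c) * b + c * (b - d) by intros; ring]
    refine (P.val.map_add _ _).trans (max_le ?_ ?_) <;> rw [map_mul]
    · exact mul_le_of_le_of_le_one h (P.val_algebraMap_coordRing_le_one hx.le g)
    · exact (mul_le_of_le_one_left' (P.val_algebraMap_le_one _)).trans h'

end Place

/-- The pole order of `x ^ i * y ^ j` at infinity, for `e = (i, j)`. -/
def weight (q r : ℕ) (e : ℕ × ℕ) : ℕ := e.1 * q ^ (r - 1) + e.2 * normExp q r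

/-- Modulo `q ^ (r - 1)` the weight is `j * c` with `c` invertible, which recovers `j`, and then
`i`. -/
theorem injOn_weight {q r : ℕ} (hq : 2 ≤ q) (hr : 2 ≤ r) :
    Set.InjOn (weight q r) {e | e.2 < q ^ (r - 1)} := by
  rintro ⟨i, j⟩ hj ⟨i', j'⟩ hj' h
  simp only [weight, Set.mem_ofPred_eq] at h hj hj'
  have hN : 0 < q ^ (r - 1) := pow_pos (by omega) _
  have h1 : j * normExp q r ≡ j' * normExp q r [MOD q ^ (r - 1)] := by
    have := congrArg (· % q ^ (r - 1)) h
    simpa [Nat.ModEq] using this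
  have h2 := Nat.ModEq.cancel_right_of_coprime (coprime_normExp hq hr).symm h1
  obtain rfl : j = j' := h2.eq_of_lt_of_lt hj hj'
  rw [Nat.add_right_cancel_iff, Nat.mul_left_inj hN.ne'] at h
  rw [h]

/-! ### Normal form of regular functions -/

section Curve

variable (q r : ℕ) (K : Type*) [Field K]

theorem x_mul_monomial (e : ℕ × ℕ) :
    x q r K * monomial q r K e = monomial q r K (e.1 + 1, e.2) := by
  simp only [monomial, pow_succ]
  ring

theorem y_mul_monomial (e : ℕ × ℕ) :
    y q r K * monomial q r K e = monomial q r K (e.1, e.2 + 1) := by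
  simp only [monomial, pow_succ]
  ring

theorem monomial_eq_sub [hr : Fact (2 ≤ r)] (i : ℕ) :
    monomial q r K (i, q ^ (r - 1)) = monomial q r K (i + normExp q r, 0) -
      ∑ j ∈ Finset.range (r - 1), monomial q r K (i, q ^ j) := by
  have h := x_pow_normExp q r K
  obtain ⟨n, rfl⟩ := Nat.exists_eq_add_of_le' (one_le_two.trans hr.out)
  rw [Finset.sum_range_succ] at h
  simp only [monomial, Nat.add_sub_cancel, ← Finset.mul_sum, pow_add, h, pow_zero]
  ring

variable [hq : Fact (IsPrimePow q)] [hr : Fact (2 ≤ r)]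

theorem mul_mem_span_monomial {f g : FunctionField q r K}
    (hf : f ∈ Algebra.adjoin K {x q r K, y q r K})
    (hg : g ∈ Submodule.span K (monomial q r K '' {e | e.2 < q ^ (r - 1)})) :
    f * g ∈ Submodule.span K (monomial q r K '' {e | e.2 < q ^ (r - 1)}) := by
  have hq2 := hq.out.two_le
  have hmem : ∀ e : ℕ × ℕ, e.2 < q ^ (r - 1) → monomial q r K e ∈
      Submodule.span K (monomial q r K '' {e | e.2 < q ^ (r - 1)}) :=
    fun e he => Submodule.subset_span ⟨e, he, rfl⟩
  have hgen : ∀ z : FunctionField q r K, (∀ e : ℕ × ℕ, e.2 < q ^ (r - 1) → z * monomial q r K e ∈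
      Submodule.span K (monomial q r K '' {e | e.2 < q ^ (r - 1)})) → ∀ g ∈
      Submodule.span K (monomial q r K '' {e | e.2 < q ^ (r - 1)}), z * g ∈
      Submodule.span K (monomial q r K '' {e | e.2 < q ^ (r - 1)}) := by
    intro z hz g hg
    induction hg using Submodule.span_induction with
    | mem g hg =>
      obtain ⟨e, he, rfl⟩ := hg
      exact hz e he
    | zero => rw [mul_zero]; exact zero_mem _
    | add g g' _ _ h h' => rw [mul_add]; exact add_mem h h'
    | smul k g _ h => rw [mul_smul_comm]; exact Submodule.smul_mem _ _ h
  induction hf using Algebra.adjoin_induction generalizing g with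
  | mem f hf =>
    obtain rfl | rfl := hf
    · refine hgen _ (fun e he => ?_) g hg
      rw [x_mul_monomial]
      exact hmem _ he
    · refine hgen _ (fun e he => ?_) g hg
      rw [y_mul_monomial]
      -- Only here does the exponent leave the range; the curve equation replaces the power of `y`
      -- by a power of `x` and lower powers of `y`.
      by_cases he' : e.2 + 1 = q ^ (r - 1)
      · rw [he', monomial_eq_sub]
        refine sub_mem (hmem _ (pow_pos (by omega) _)) (sum_mem fun j hj => hmem _ ?_)
        exact Nat.pow_lt_pow_right hq2 (Finset.mem_range.1 hj)
      · exact hmem _ (lt_of_le_of_ne he he')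
  | algebraMap k => rw [← Algebra.smul_def]; exact Submodule.smul_mem _ _ hg
  | add f f' _ _ h h' => rw [add_mul]; exact add_mem (h hg) (h' hg)
  | mul f f' _ _ h h' => rw [mul_assoc]; exact h (h' hg)

theorem exists_linearCombination_eq (f : CoordRing q r K) :
    ∃ l ∈ Finsupp.supported K K {e : ℕ × ℕ | e.2 < q ^ (r - 1)},
      Finsupp.linearCombination K (monomial q r K) l = algebraMap _ _ f := by
  rw [← Finsupp.mem_span_image_iff_linearCombination, ← mul_one (algebraMap _ _ f)]
  refine mul_mem_span_monomial q r K (algebraMap_mem_adjoin q r K f)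
    (Submodule.subset_span ⟨(0, 0), ?_, ?_⟩)
  · exact pow_pos (by have := hq.out.two_le; omega : 0 < q) _
  · simp [monomial]

end Curve

/-! ### Valuations at the two points -/

namespace Place

variable {q r : ℕ} {K : Type*} [Field K] [hq : Fact (IsPrimePow q)] [hr : Fact (2 ≤ r)]
  (P : Place K (FunctionField q r K))

/-- From `c * log|x| = q ^ (r - 1) * log|y|` and coprimality; that `k = 1` needs the normal form. -/
theorem exists_val_eq_exp_mul (hx : 1 < P.val (x q r K)) :
    ∃ k : ℤ, 0 < k ∧ P.val (x q r K) = exp (k * (q ^ (r - 1) : ℕ)) ∧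
      P.val (y q r K) = exp (k * normExp q r) := by
  have hq2 := hq.out.two_le
  have hy := P.one_lt_val_y hx
  have h := P.val_x_pow_of_one_lt hy
  have hx0 : P.val (x q r K) ≠ 0 := (zero_lt_one.trans hx).ne'
  have hy0 : P.val (y q r K) ≠ 0 := (zero_lt_one.trans hy).ne'
  rw [← exp_log hx0, ← exp_zero, exp_lt_exp] at hx
  rw [← exp_log hx0, ← exp_log hy0, ← exp_nsmul, ← exp_nsmul, exp_inj, nsmul_eq_mul,
    nsmul_eq_mul] at h
  have hcop : IsCoprime ((q ^ (r - 1) : ℕ) : ℤ) (normExp q r : ℤ) :=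
    Nat.isCoprime_iff_coprime.2 (coprime_normExp hq2 hr.out).symm
  obtain ⟨k, hk⟩ := hcop.dvd_of_dvd_mul_left (Dvd.intro _ h.symm)
  have hN : 0 < ((q ^ (r - 1) : ℕ) : ℤ) := by exact_mod_cast pow_pos (by omega : 0 < q) (r - 1)
  rw [hk] at hx h
  refine ⟨k, pos_of_mul_pos_right hx hN.le, ?_, ?_⟩
  · rw [← exp_log hx0, hk, mul_comm]
  · rw [← exp_log hy0, exp_inj]
    refine mul_left_cancel₀ hN.ne' ?_
    rw [← h]
    ring

theorem val_monomial_of_val_eq {k : ℤ} (hx : P.val (x q r K) = exp (k * (q ^ (r - 1) : ℕ)))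
    (hy : P.val (y q r K) = exp (k * normExp q r)) (e : ℕ × ℕ) :
    P.val (monomial q r K e) = exp (k * weight q r e) := by
  rw [monomial, map_mul, map_pow, map_pow, hx, hy, ← exp_nsmul, ← exp_nsmul, ← exp_add, weight]
  congr 1
  simp only [nsmul_eq_mul]
  push_cast
  ring

theorem exists_val_linearCombination_monomial {k : ℤ} (hk : 0 < k)
    (hx : P.val (x q r K) = exp (k * (q ^ (r - 1) : ℕ)))
    (hy : P.val (y q r K) = exp (k * normExp q r)) {l : ℕ × ℕ →₀ K}
    (hl : l ∈ Finsupp.supported K K {e : ℕ × ℕ | e.2 < q ^ (r - 1)}) (hl0 : l ≠ 0) :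
    ∃ e ∈ l.support, P.val (Finsupp.linearCombination K (monomial q r K) l) =
      exp (k * weight q r e) ∧ ∀ e' ∈ l.support, weight q r e' ≤ weight q r e := by
  have hval := P.val_monomial_of_val_eq hx hy
  have hinj : Set.InjOn (fun e => P.val (monomial q r K e)) l.support := by
    intro e he e' he' h
    simp only [hval, exp_inj] at h
    refine injOn_weight hq.out.two_le hr.out (hl he) (hl he') ?_
    exact_mod_cast mul_left_cancel₀ hk.ne' h
  obtain ⟨e, he, h1, h2⟩ := P.exists_val_linearCombination (monomial q r K) l hl0 hinj
  refine ⟨e, he, h1.trans (hval e), fun e' he' => ?_⟩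
  have := h2 e' he'
  rw [hval, hval, exp_le_exp] at this
  exact_mod_cast le_of_mul_le_mul_left this hk

/-- All orders of nonzero elements of `R` are multiples of `k`, and a uniformizer is a quotient of
two of them, so `k` divides `1`. -/
theorem val_eq_exp_of_one_lt (hx : 1 < P.val (x q r K)) :
    P.val (x q r K) = exp ((q ^ (r - 1) : ℕ) : ℤ) ∧ P.val (y q r K) = exp (normExp q r : ℤ) := by
  obtain ⟨k, hk, hx', hy'⟩ := P.exists_val_eq_exp_mul hx
  have hR : ∀ f : CoordRing q r K, f ≠ 0 → ∃ n : ℤ, P.val (algebraMap _ _ f) = exp (k * n) := by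
    intro f hf
    obtain ⟨l, hl, hlf⟩ := exists_linearCombination_eq q r K f
    obtain ⟨e, _, he, _⟩ := P.exists_val_linearCombination_monomial hk hx' hy' hl (by
      rintro rfl
      rw [map_zero, eq_comm, map_eq_zero_iff _ (IsFractionRing.injective _ _)] at hlf
      exact hf hlf)
    exact ⟨_, hlf ▸ he⟩
  obtain ⟨f, hf⟩ := P.exists_val_eq_exp_neg_one
  obtain ⟨a, b, hb, rfl⟩ := IsFractionRing.div_surjective (A := CoordRing q r K) f
  obtain ⟨m, hm⟩ := hR b (nonZeroDivisors.ne_zero hb)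
  obtain ⟨n, hn⟩ := hR a (by
    rintro rfl
    rw [map_zero, zero_div, map_zero] at hf
    exact exp_ne_zero hf.symm)
  rw [map_div₀, hm, hn, ← exp_sub, exp_inj] at hf
  have hk1 : k = 1 := Int.eq_one_of_dvd_one hk.le ⟨m - n, by linarith⟩
  rw [hx', hy', hk1, one_mul, one_mul]
  exact ⟨rfl, rfl⟩

/-- Both valuations of an element of `R` are given by the largest weight in its expansion. -/
theorem eq_of_one_lt_val_x {P Q : Place K (FunctionField q r K)} (hP : 1 < P.val (x q r K))
    (hQ : 1 < Q.val (x q r K)) : P = Q := by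
  obtain ⟨hPx, hPy⟩ := P.val_eq_exp_of_one_lt hP
  obtain ⟨hQx, hQy⟩ := Q.val_eq_exp_of_one_lt hQ
  rw [← one_mul ((_ : ℕ) : ℤ)] at hPx hPy hQx hQy
  have hR : ∀ f : CoordRing q r K, P.val (algebraMap _ _ f) = Q.val (algebraMap _ _ f) := by
    intro f
    obtain ⟨l, hl, hlf⟩ := exists_linearCombination_eq q r K f
    rw [← hlf]
    obtain rfl | hl0 := eq_or_ne l 0
    · simp
    obtain ⟨e, he, h1, h2⟩ := P.exists_val_linearCombination_monomial one_pos hPx hPy hl hl0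
    obtain ⟨e', he', h1', h2'⟩ := Q.exists_val_linearCombination_monomial one_pos hQx hQy hl hl0
    rw [h1, h1', le_antisymm (h2 e' he') (h2' e he)]
  refine ext_of_val fun f => ?_
  obtain ⟨a, b, hb, rfl⟩ := IsFractionRing.div_surjective (A := CoordRing q r K) f
  rw [map_div₀, map_div₀, hR, hR]

/-- The height one prime ideal of the origin. -/
noncomputable def originIdeal (q r : ℕ) (K : Type*) [Field K] [Fact (IsPrimePow q)]
    [Fact (2 ≤ r)] : HeightOneSpectrum (CoordRing q r K) where
  asIdeal := RingHom.ker (evalZero q r K)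
  isPrime := RingHom.ker_isPrime _
  ne_bot := by
    intro h
    have h1 : AdjoinRoot.of (curvePoly q r K) X ∈ RingHom.ker (evalZero q r K) := by
      simp [evalZero]
    rw [h, Ideal.mem_bot] at h1
    refine transcendental_y q r K ?_
    rw [y, h1, map_zero]
    exact isAlgebraic_zero

theorem exists_val_y_lt_one (hK : (q : K) = 0) :
    ∃ P : Place K (FunctionField q r K), P.val (y q r K) < 1 := by
  have := isDedekindDomain_coordRing q r K hK
  refine ⟨ofHeightOneSpectrum (originIdeal q r K), ofHeightOneSpectrum_val_lt_one _ ?_⟩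
  simp [originIdeal, evalZero]

theorem val_algebraMap_le_of_mem_originIdeal (hy : P.val (y q r K) < 1) {f : CoordRing q r K}
    (hf : f ∈ (originIdeal q r K).asIdeal) : P.val (algebraMap _ _ f) ≤ P.val (x q r K) := by
  have := P.val_algebraMap_sub_evalZero_le hy f
  rwa [show evalZero q r K f = 0 from hf, map_zero, sub_zero] at this

theorem eq_of_val_y_lt_one (hK : (q : K) = 0) {P Q : Place K (FunctionField q r K)}
    (hP : P.val (y q r K) < 1) (hQ : Q.val (y q r K) < 1) : P = Q := by
  have := isDedekindDomain_coordRing q r K hK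
  have h : ∀ P : Place K (FunctionField q r K), P.val (y q r K) < 1 →
      P = ofHeightOneSpectrum (originIdeal q r K) := fun P hP =>
    (P.eq_ofHeightOneSpectrum (originIdeal q r K)
      (P.val_algebraMap_coordRing_le_one (P.val_x_lt_one hP).le) fun f hf =>
        (P.val_algebraMap_le_of_mem_originIdeal hP hf).trans_lt (P.val_x_lt_one hP)).2
  rw [h P hP, h Q hQ]

theorem val_x_eq_exp_neg_one (hK : (q : K) = 0) (hy : P.val (y q r K) < 1) :
    P.val (x q r K) = exp (-1 : ℤ) := by
  have := isDedekindDomain_coordRing q r K hK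
  have hx := P.val_x_lt_one hy
  obtain ⟨hd, hP⟩ := P.eq_ofHeightOneSpectrum (originIdeal q r K)
    (P.val_algebraMap_coordRing_le_one hx.le) fun f hf =>
      (P.val_algebraMap_le_of_mem_originIdeal hy hf).trans_lt hx
  obtain ⟨f, hf⟩ := P.exists_val_eq_exp_neg_one
  have hf1 : P.val f < 1 := by
    rw [hf, ← exp_zero, exp_lt_exp]
    omega
  have hv : (originIdeal q r K).valuation (FunctionField q r K) f ≤ 1 := by
    rw [← ofHeightOneSpectrum_val_le_one_iff (K := K), ← hP]
    exact hf1.le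
  -- The numerator `n` of a uniformizer `f = n / d` lies in the ideal of the origin, so `exp (-1) =
  -- |n| ≤ |x| < 1`.
  obtain ⟨n, d, hnd⟩ := (originIdeal q r K).exists_primeCompl_mul_eq_of_integer f hv
  have hn : P.val (algebraMap _ _ n) = exp (-1 : ℤ) := by
    rw [← hnd, map_mul, hd d d.2, mul_one, hf]
  have hnm : n ∈ (originIdeal q r K).asIdeal := by
    by_contra h
    rw [← hf, hd n h] at hn
    exact hf1.ne hn.symm
  have h1 := P.val_algebraMap_le_of_mem_originIdeal hy hnm
  rw [hn] at h1
  have hx0 : P.val (x q r K) ≠ 0 := fun h => by simp [h] at h1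
  rw [← exp_log hx0, ← exp_zero, exp_lt_exp] at hx
  rw [← exp_log hx0, exp_le_exp] at h1
  rw [← exp_log hx0, exp_inj]
  omega

theorem val_monomial_of_val_y_lt_one (hK : (q : K) = 0) (hy : P.val (y q r K) < 1) (e : ℕ × ℕ) :
    P.val (monomial q r K e) = exp (-(e.1 + e.2 * normExp q r : ℕ) : ℤ) := by
  rw [monomial, map_mul, map_pow, map_pow, ← P.val_x_pow_of_lt_one hy,
    P.val_x_eq_exp_neg_one hK hy, ← exp_nsmul, ← exp_nsmul, ← exp_nsmul, ← exp_add]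
  congr 1
  simp only [nsmul_eq_mul]
  push_cast
  ring

end Place

theorem natCast_eq_zero_of_natCard_eq_pow {q r : ℕ} {K : Type*} [Field K] [Finite K]
    (hK : Nat.card K = q ^ r) : (q : K) = 0 := by
  have := Fintype.ofFinite K
  have h : ((q ^ r : ℕ) : K) = 0 := by
    rw [← hK, Nat.card_eq_fintype_card]
    exact Nat.cast_card_eq_zero K
  rw [Nat.cast_pow] at h
  exact eq_zero_of_pow_eq_zero h

theorem finrank_span_image_eq_ncard {K V ι : Type*} [Field K] [AddCommGroup V] [Module K V]
    {v : ι → V} {S : Set ι} (hS : S.Finite) (hv : LinearIndepOn K v S) :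
    Module.finrank K (Submodule.span K (v '' S)) = S.ncard := by
  have := (hS.image v).fintype
  rw [finrank_span_set_eq_card hv.id_image, ← Set.ncard_eq_toFinset_card',
    hv.injOn.ncard_image]

/-! ### Counting exponents -/

section BasisExponents

variable {q r : ℕ} {s : ℤ}

theorem finite_basisExponents (q r : ℕ) (s : ℤ) : (basisExponents q r s).Finite :=
  ((Set.finite_Iio (q ^ r)).prod (Set.finite_Iio (q ^ (r - 1)))).subset
    fun _ he => ⟨he.1, he.2.1⟩

/-- Makes the condition `i < q ^ r` automatic and, as `q < c`, separates the orders at the origin.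
-/
theorem fst_lt_of_weight_le (hr : 2 ≤ r) (hs : s < (q ^ r : ℕ)) {e : ℕ × ℕ}
    (he : (weight q r e : ℤ) ≤ s) : e.1 < q := by
  have h : weight q r e < q ^ r := by exact_mod_cast he.trans_lt hs
  obtain ⟨n, rfl⟩ := Nat.exists_eq_add_of_le' (one_le_two.trans hr)
  rw [weight, Nat.add_sub_cancel, pow_succ'] at h
  exact lt_of_mul_lt_mul_right ((Nat.le_add_right _ _).trans_lt h) (Nat.zero_le _)

theorem mem_basisExponents_iff (hr : 2 ≤ r) (hs : s < (q ^ r : ℕ)) {e : ℕ × ℕ} :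
    e ∈ basisExponents q r s ↔ e.2 < q ^ (r - 1) ∧ (weight q r e : ℤ) ≤ s := by
  refine ⟨fun h => h.2, fun h => ⟨?_, h⟩⟩
  exact (fst_lt_of_weight_le hr hs h.2).trans_le (Nat.le_self_pow (by omega) q)

theorem ncard_basisExponents {d a b : ℕ} (hq : 2 ≤ q) (hr : 2 ≤ r) (hs : s < (q ^ r : ℕ))
    (hdq : d < q) (ha : a ≤ normExp q r - 1) (hb : b ≤ d) (hsd : s = (d : ℤ) * normExp q r - a) :
    (basisExponents q r s).ncard =
      {e ∈ basisExponents q r s | b ≤ e.1 + e.2 * normExp q r}.ncard + b := by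
  have hqc := self_lt_normExp hq hr
  have hdiff : basisExponents q r s \ {e ∈ basisExponents q r s | b ≤ e.1 + e.2 * normExp q r} =
      (fun i => (i, 0)) '' Set.Iio b := by
    ext ⟨i, j⟩
    simp only [Set.mem_sdiff, Set.mem_sep_iff, not_and, not_le, Set.mem_image, Set.mem_Iio,
      Prod.mk.injEq]
    constructor
    · rintro ⟨h, h'⟩
      have hlt := h' h
      -- A factor `y` already gives order `c > q > d ≥ b`.
      obtain rfl : j = 0 := by
        by_contra hj
        have := Nat.le_mul_of_pos_left (normExp q r) (Nat.pos_of_ne_zero hj)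
        omega
      exact ⟨i, by omega, rfl, rfl⟩
    · rintro ⟨i, hi, rfl, rfl⟩
      refine ⟨(mem_basisExponents_iff hr hs).2 ⟨pow_pos (by omega) _, ?_⟩, fun _ => by omega⟩
      -- As `i < b ≤ d` and `a < c`, one has `i * q ^ (r - 1) + a ≤ (i + 1) * c ≤ d * c`.
      have h1 : (i + 1) * normExp q r ≤ d * normExp q r := Nat.mul_le_mul_right _ (by omega)
      have h2 : i * q ^ (r - 1) ≤ i * normExp q r := Nat.mul_le_mul_left _ (lt_normExp hq hr).le
      rw [add_mul, one_mul] at h1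
      have h3 : i * q ^ (r - 1) + a ≤ d * normExp q r := by omega
      rw [hsd, weight, zero_mul, add_zero, le_sub_iff_add_le]
      exact_mod_cast h3
  rw [← Set.ncard_sdiff_add_ncard_of_subset (Set.sep_subset _ _) (finite_basisExponents q r s),
    hdiff, add_comm,
    Set.ncard_image_of_injective _ fun i j h => (Prod.mk.inj h).1]
  simp

end BasisExponents

/-! ### Riemann–Roch spaces and spaces of sections -/

section RiemannRoch

variable {q r : ℕ} {K : Type*} [Field K] [hq : Fact (IsPrimePow q)] [hr : Fact (2 ≤ r)]
  {Qinf Q0 : Place K (FunctionField q r K)}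

theorem mem_riemannRoch_single {F : Type*} [Field F] [Algebra K F] {Q : Place K F} {s : ℤ} {f : F} :
    f ∈ riemannRoch (Finsupp.single Q s) ↔ Q.val f ≤ exp s ∧ ∀ P ≠ Q, P.val f ≤ 1 := by
  change (∀ P, P.val f ≤ exp (Finsupp.single Q s P)) ↔ _
  constructor
  · intro h
    refine ⟨by simpa using h Q, fun P hP => ?_⟩
    have := h P
    rwa [Finsupp.single_eq_of_ne hP, exp_zero] at this
  · rintro ⟨h, h'⟩ P
    obtain rfl | hP := eq_or_ne P Q
    · simpa using h
    · rw [Finsupp.single_eq_of_ne hP, exp_zero]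
      exact h' P hP

theorem Place.val_monomial_of_one_lt (hQ : 1 < Qinf.val (x q r K)) (e : ℕ × ℕ) :
    Qinf.val (monomial q r K e) = exp (weight q r e : ℤ) := by
  obtain ⟨hx, hy⟩ := Qinf.val_eq_exp_of_one_lt hQ
  rw [← one_mul ((_ : ℕ) : ℤ)] at hx hy
  rw [Qinf.val_monomial_of_val_eq hx hy, one_mul]

theorem exists_val_linearCombination_infinity (hQ : 1 < Qinf.val (x q r K)) {l : ℕ × ℕ →₀ K}
    (hl : l ∈ Finsupp.supported K K {e : ℕ × ℕ | e.2 < q ^ (r - 1)}) (hl0 : l ≠ 0) :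
    ∃ e ∈ l.support, Qinf.val (Finsupp.linearCombination K (monomial q r K) l) =
      exp (weight q r e : ℤ) ∧ ∀ e' ∈ l.support, weight q r e' ≤ weight q r e := by
  obtain ⟨hx, hy⟩ := Qinf.val_eq_exp_of_one_lt hQ
  rw [← one_mul ((_ : ℕ) : ℤ)] at hx hy
  obtain ⟨e, he, h1, h2⟩ := Qinf.exists_val_linearCombination_monomial one_pos hx hy hl hl0
  exact ⟨e, he, by rw [h1, one_mul], h2⟩

theorem linearIndepOn_monomial (hQ : 1 < Qinf.val (x q r K)) (s : ℤ) :
    LinearIndepOn K (monomial q r K) (basisExponents q r s) := by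
  refine LinearIndepOn.mono (s := {e : ℕ × ℕ | e.2 < q ^ (r - 1)}) ?_ fun e he => he.2.1
  rw [linearIndepOn_iff]
  intro l hl h0
  by_contra hl0
  obtain ⟨e, _, h, _⟩ := exists_val_linearCombination_infinity hQ hl hl0
  rw [h0, map_zero] at h
  exact exp_ne_zero h.symm

theorem span_monomial_eq_riemannRoch (hK : (q : K) = 0) (hQ : 1 < Qinf.val (x q r K)) {s : ℤ}
    (hs : s < (q ^ r : ℕ)) :
    Submodule.span K (monomial q r K '' basisExponents q r s) =
      riemannRoch (Finsupp.single Qinf s) := by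
  have hq2 := hq.out.two_le
  apply le_antisymm
  · rw [Submodule.span_le]
    rintro _ ⟨e, he, rfl⟩
    refine mem_riemannRoch_single.2 ⟨?_, fun P hP => ?_⟩
    · rw [Place.val_monomial_of_one_lt hQ, exp_le_exp]
      exact he.2.2
    · have hx : P.val (x q r K) ≤ 1 := le_of_not_gt fun h => hP (Place.eq_of_one_lt_val_x h hQ)
      rw [monomial, map_mul, map_pow, map_pow]
      exact mul_le_one' (pow_le_one₀ zero_le hx) (pow_le_one₀ zero_le (P.val_y_le_one hx))
  · intro f hf
    obtain ⟨hfQ, hfP⟩ := mem_riemannRoch_single.1 hf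
    have := isDedekindDomain_coordRing q r K hK
    -- A place whose ring contains `R` is not `Qinf`, since `x` has a pole there; so `f` is regular
    -- on the affine curve.
    obtain ⟨g, rfl⟩ := Place.exists_algebraMap_eq_of_val_le_one (K := K) (B := CoordRing q r K)
      (f := f) fun P hP => hfP P fun h => (hP (AdjoinRoot.root _)).not_gt (h ▸ hQ)
    obtain ⟨l, hl, hlg⟩ := exists_linearCombination_eq q r K g
    rw [← hlg] at hfQ ⊢
    refine (Finsupp.mem_span_image_iff_linearCombination K).2 ⟨l, fun e he => ?_, rfl⟩
    have hl0 : l ≠ 0 := fun h => by simp [h] at he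
    obtain ⟨e', _, h1, h2⟩ := exists_val_linearCombination_infinity hQ hl hl0
    rw [h1, exp_le_exp] at hfQ
    refine (mem_basisExponents_iff hr.out hs).2 ⟨hl he, le_trans ?_ hfQ⟩
    exact_mod_cast h2 e he

theorem mem_sectionsOfForms_iff (hQ : 1 < Qinf.val (x q r K)) (hQ0 : Q0.val (y q r K) < 1)
    {d a b : ℕ} {s : ℤ} (hs : s = (d : ℤ) * normExp q r - a) {f : FunctionField q r K} :
    f ∈ sectionsOfForms (coords q r K) d
        (Finsupp.single Qinf (a : ℤ) + Finsupp.single Q0 (b : ℤ)) ↔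
      f ∈ riemannRoch (Finsupp.single Qinf s) ∧ Q0.val f ≤ exp (-(b : ℤ)) := by
  have hne : Qinf ≠ Q0 := by
    rintro rfl
    exact hQ.not_gt (Qinf.val_x_lt_one hQ0)
  have hinf : Qinf.height (coords q r K) = exp (normExp q r : ℤ) := by
    rw [← (Qinf.val_eq_exp_of_one_lt hQ).2]
    have h1 := Qinf.val_x_lt_val_y hQ
    have h2 := Qinf.one_lt_val_y hQ
    simp [Place.height, coords, h1.le, h2.le]
  have hfin : ∀ P ≠ Qinf, P.height (coords q r K) = 1 := by
    intro P hP
    have hx : P.val (x q r K) ≤ 1 := le_of_not_gt fun h => hP (Place.eq_of_one_lt_val_x h hQ)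
    simp [Place.height, coords, hx, P.val_y_le_one hx]
  have h2 : coords q r K 2 = 1 := rfl
  have hbinf : exp (-(a : ℤ)) * exp (normExp q r : ℤ) ^ d = exp s := by
    rw [← exp_nsmul, ← exp_add, hs, nsmul_eq_mul]
    congr 1
    ring
  rw [mem_riemannRoch_single]
  change (∀ P, P.val f ≤ exp (-((Finsupp.single Qinf (a : ℤ) + Finsupp.single Q0 (b : ℤ)) P)) *
    (P.height (coords q r K) / P.val (coords q r K 2)) ^ d) ↔ _
  simp only [h2, map_one, div_one, Finsupp.add_apply]
  constructor
  · intro h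
    have h0 := h Q0
    rw [hfin Q0 hne.symm, one_pow, mul_one, Finsupp.single_eq_of_ne hne.symm,
      Finsupp.single_eq_same, zero_add] at h0
    refine ⟨⟨?_, fun P hP => ?_⟩, h0⟩
    · have := h Qinf
      rwa [hinf, Finsupp.single_eq_same, Finsupp.single_eq_of_ne hne, add_zero, hbinf] at this
    · obtain rfl | hP0 := eq_or_ne P Q0
      · refine h0.trans ?_
        rw [← exp_zero, exp_le_exp]
        omega
      · have := h P
        rwa [hfin P hP, Finsupp.single_eq_of_ne hP, Finsupp.single_eq_of_ne hP0, add_zero, neg_zero,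
          exp_zero, one_pow, mul_one] at this
  · rintro ⟨⟨h, h'⟩, h0⟩ P
    obtain rfl | hP := eq_or_ne P Qinf
    · rwa [hinf, Finsupp.single_eq_same, Finsupp.single_eq_of_ne hne, add_zero, hbinf]
    obtain rfl | hP0 := eq_or_ne P Q0
    · rwa [hfin P hP, one_pow, mul_one, Finsupp.single_eq_of_ne hP, Finsupp.single_eq_same,
        zero_add]
    · rw [hfin P hP, Finsupp.single_eq_of_ne hP, Finsupp.single_eq_of_ne hP0, add_zero, neg_zero,
        exp_zero, one_pow, mul_one]
      exact h' P hP

/-- With `i < c`, the order `i + j * c` determines `i` as its residue modulo `c`. -/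
theorem injOn_val_monomial_origin (hK : (q : K) = 0) (hQ0 : Q0.val (y q r K) < 1) {s : ℤ}
    (hs : s < (q ^ r : ℕ)) :
    Set.InjOn (fun e => Q0.val (monomial q r K e)) (basisExponents q r s) := by
  have hq2 := hq.out.two_le
  have hqc := self_lt_normExp hq2 hr.out
  have hlt : ∀ e ∈ basisExponents q r s, e.1 < normExp q r := fun e he =>
    (fst_lt_of_weight_le hr.out hs he.2.2).trans hqc
  rintro ⟨i, j⟩ he ⟨i', j'⟩ he' h
  simp only [Q0.val_monomial_of_val_y_lt_one hK hQ0, exp_inj, neg_inj, Nat.cast_inj] at h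
  have hi := hlt _ he
  have hi' := hlt _ he'
  simp only at hi hi'
  have h1 := congrArg (· % normExp q r) h
  simp only [Nat.add_mul_mod_self_right, Nat.mod_eq_of_lt hi, Nat.mod_eq_of_lt hi'] at h1
  subst h1
  rw [Nat.add_left_cancel_iff, Nat.mul_left_inj (by omega)] at h
  rw [h]

theorem sectionsOfForms_eq_span (hK : (q : K) = 0) (hQ : 1 < Qinf.val (x q r K))
    (hQ0 : Q0.val (y q r K) < 1) {d a b : ℕ} {s : ℤ} (hsd : s = (d : ℤ) * normExp q r - a)
    (hs : s < (q ^ r : ℕ)) :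
    sectionsOfForms (coords q r K) d
        (Finsupp.single Qinf (a : ℤ) + Finsupp.single Q0 (b : ℤ)) =
      Submodule.span K (monomial q r K ''
        {e ∈ basisExponents q r s | Q0.val (monomial q r K e) ≤ exp (-(b : ℤ))}) := by
  apply le_antisymm
  · intro f hf
    rw [mem_sectionsOfForms_iff hQ hQ0 hsd, ← span_monomial_eq_riemannRoch hK hQ hs,
      Finsupp.mem_span_image_iff_linearCombination] at hf
    obtain ⟨⟨l, hl, rfl⟩, hf⟩ := hf
    refine (Finsupp.mem_span_image_iff_linearCombination K).2
      ⟨l, fun e he => ⟨hl he, ?_⟩, rfl⟩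
    have hl0 : l ≠ 0 := fun h => by simp [h] at he
    obtain ⟨e', _, h1, h2⟩ := Q0.exists_val_linearCombination (monomial q r K) l hl0
      ((injOn_val_monomial_origin hK hQ0 hs).mono hl)
    exact (h2 e he).trans (h1 ▸ hf)
  · rw [Submodule.span_le]
    rintro _ ⟨e, he, rfl⟩
    refine (mem_sectionsOfForms_iff hQ hQ0 hsd).2 ⟨?_, he.2⟩
    rw [← span_monomial_eq_riemannRoch hK hQ hs]
    exact Submodule.subset_span ⟨e, he.1, rfl⟩

end RiemannRoch

end NormTrace

open NormTrace in
theorem mainTheorem9 (q r : ℕ) [Fact (IsPrimePow q)] [Fact (2 ≤ r)]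
    (K : Type*) [Field K] [Finite K] (hK : Nat.card K = q ^ r) :
    -- the points of the normalization over `(0 : 1 : 0)` and over `(0 : 0 : 1)`
    ∃ Qinf Q0 : Place K (FunctionField q r K),
      (∀ P : Place K (FunctionField q r K), P.LiesOver (coords q r K) ![0, 1, 0] ↔ P = Qinf) ∧
      (∀ P : Place K (FunctionField q r K), P.LiesOver (coords q r K) ![0, 0, 1] ↔ P = Q0) ∧
      ∀ d a b : ℕ, 0 < d → d < q → a ≤ normExp q r - 1 → 0 < b → b ≤ d →
        ∀ s : ℤ, s = (d : ℤ) * normExp q r - a →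
          -- the monomials form a basis of `L(s Q_∞)`
          LinearIndepOn K (monomial q r K) (basisExponents q r s) ∧
          Submodule.span K (monomial q r K '' basisExponents q r s)
            = riemannRoch (Finsupp.single Qinf s) ∧
          -- the dimension of the space of sections
          (Module.finrank K
              (sectionsOfForms (coords q r K) d
                (Finsupp.single Qinf (a : ℤ) + Finsupp.single Q0 (b : ℤ))) : ℤ)
            = Module.finrank K (riemannRoch (Finsupp.single Qinf s)) - b ∧
          -- it is spanned by the basis monomials vanishing to order at least `b` at `Q_0`
          sectionsOfForms (coords q r K) d
              (Finsupp.single Qinf (a : ℤ) + Finsupp.single Q0 (b : ℤ))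
            = Submodule.span K (monomial q r K ''
                {e ∈ basisExponents q r s | Q0.val (monomial q r K e) ≤ WithZero.exp (-(b : ℤ))}) := by
  have hq0 := natCast_eq_zero_of_natCard_eq_pow hK
  have hq2 : 2 ≤ q := (Fact.out : IsPrimePow q).two_le
  have hr2 : 2 ≤ r := Fact.out
  have hy := adjoin_y_eq_top q r K
  obtain ⟨Qinf, hQ⟩ := exists_one_lt_val (transcendental_x q r K) hy
    (isSeparable_of_aeval_eq (aeval_y_tracePoly q r K)
      (derivative_tracePoly q r K (one_le_two.trans hr2) hq0) _
      (e := IntermediateField.AdjoinSimple.gen K (x q r K)) rfl)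
  obtain ⟨Q0, hQ0⟩ := Place.exists_val_y_lt_one (r := r) hq0
  refine ⟨Qinf, Q0, fun P => ?_, fun P => ?_, ?_⟩
  · rw [P.liesOver_infinity_iff]
    exact ⟨fun h => Place.eq_of_one_lt_val_x h hQ, fun h => h ▸ hQ⟩
  · rw [P.liesOver_origin_iff]
    exact ⟨fun h => Place.eq_of_val_y_lt_one hq0 h hQ0, fun h => h ▸ hQ0⟩
  intro d a b _ hdq ha _ hb s hsd
  -- `s ≤ d * c ≤ (q - 1) * c = q ^ r - 1`.
  have hs : s < (q ^ r : ℕ) := by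
    have h1 := Nat.mul_le_mul_right (normExp q r) (by omega : d ≤ q - 1)
    rw [sub_one_mul_normExp hq2] at h1
    have h2 : 0 < q ^ r := pow_pos (by omega) r
    have h3 : ((d * normExp q r : ℕ) : ℤ) < (q ^ r : ℕ) := by exact_mod_cast (by omega)
    rw [Nat.cast_mul] at h3
    omega
  have hli := linearIndepOn_monomial hQ s
  have hspan := span_monomial_eq_riemannRoch hq0 hQ hs
  have hsec := sectionsOfForms_eq_span hq0 hQ hQ0 (b := b) hsd hs
  refine ⟨hli, hspan, ?_, hsec⟩
  have hset : {e ∈ basisExponents q r s | Q0.val (monomial q r K e) ≤ WithZero.exp (-(b : ℤ))} =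
      {e ∈ basisExponents q r s | b ≤ e.1 + e.2 * normExp q r} := by
    ext e
    simp only [Set.mem_sep_iff, Q0.val_monomial_of_val_y_lt_one hq0 hQ0, WithZero.exp_le_exp, neg_le_neg_iff,
      Nat.cast_le]
  rw [hsec, ← hspan, hset, finrank_span_image_eq_ncard (finite_basisExponents q r s) hli,
    finrank_span_image_eq_ncard ((finite_basisExponents q r s).subset (Set.sep_subset _ _))
      (hli.mono (Set.sep_subset _ _)), ncard_basisExponents hq2 hr2 hs hdq ha hb hsd]
  push_cast
  ring
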